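/- Let $p=1+4t^2$ be a prime with $t$ an even integer, and let $\omega$ be a generator of the multiplicative group $\mathbb{F}_p^*$. Let $C_0=\langle\omega^4\rangle\le\mathbb{F}_p^*$ and $C_2=\omega^2C_0$. Let $H$ be the additive group of $\mathbb{F}_p$, let $K=\langle\rho\rangle$ be the group of automorphisms of $H$ generated by $\rho:x\mapsto\omega^4x$, and let $G=H\rtimes K$ be the semidirect product with multiplication $(h,\phi)(h',\phi')=(h+\phi(h'),\phi\phi')$. Put $$W=(-1+C_2,K)=\{(-1+d,\phi): d\in C_2,\ \phi\in K\}\subset G.$$ Then the Cayley digraph $\mathrm{Cay}(G,W)$, with vertex set $G$ and an arc from $x$ to $y$ exactly when $x^{-1}y\in W$, is a directed strongly regular graph with parameters $$(v,k,\lambda,\mu,\tau)=\left(\frac{(p-1)p}{4},\ \frac{(p-1)^2}{16},\ \frac{(p-1)^2}{64}-\frac{p-1}{16},\ \frac{(p-1)^2}{64},\ \frac{(p-1)^2}{64}\right).$$ Here a directed strongly regular graph with parameters $(v,k,\lambda,\mu,\tau)$ is a directed graph without loops on $v$ vertices such that every vertex has out-degree and in-degree $k$; for every vertex $x$ there are exactly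 $\tau$ vertices $y$ such that both $(x,y)$ and $(y,x)$ are arcs; and for any two distinct vertices $x,y$, the number of vertices $z$ such that $(x,z)$ and $(z,y)$ are arcs is $\lambda$ if $(x,y)$ is an arc, and $\mu$ otherwise. -/

import Mathlib

/-- A directed strongly regular graph with parameters `(v, k, l, m, t)`: a finite directed graph
without loops on `v` vertices, in which every vertex has out-degree and in-degree `k`, every vertex
lies on exactly `t` undirected edges, and the number of directed paths of length two from `x` to
`y ≠ x` is `l` if there is an arc from `x` to `y`, and `m` otherwise. -/
structure Digraph.IsDSRGWith {V : Type*} (Γ : Digraph V) (v k l m t : ℕ) : Prop where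
  finite : Finite V
  card : Nat.card V = v
  loopless : ∀ x : V, ¬ Γ.Adj x x
  out_degree : ∀ x : V, {y : V | Γ.Adj x y}.ncard = k
  in_degree : ∀ x : V, {z : V | Γ.Adj z x}.ncard = k
  undirected : ∀ x : V, {y : V | Γ.Adj x y ∧ Γ.Adj y x}.ncard = t
  paths_of_adj : ∀ x y : V, x ≠ y → Γ.Adj x y → {z : V | Γ.Adj x z ∧ Γ.Adj z y}.ncard = l
  paths_of_not_adj : ∀ x y : V, x ≠ y → ¬ Γ.Adj x y → {z : V | Γ.Adj x z ∧ Γ.Adj z y}.ncard = m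

/-- The Cayley digraph `Cay(G, S)`: there is an arc from `x` to `y` iff `y = x * s` for some `s` in
the connection set `S`. -/
def cayleyDigraph {G : Type*} [Group G] (S : Set G) : Digraph G where
  Adj x y := x⁻¹ * y ∈ S

/-- The cyclotomic coset `C_i = ω ^ i • ⟨ω ^ e⟩` of order `e`, as a subset of the field `F`. -/
def cyclotomicCoset {F : Type*} [Field F] (ω : Fˣ) (e i : ℕ) : Set F :=
  {x | ∃ y ∈ Subgroup.zpowers (ω ^ e), x = ((ω ^ i * y : Fˣ) : F)}

/-- The automorphism `x ↦ u * x` of the additive group of `F` (written multiplicatively). -/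
def scaling {F : Type*} [Field F] (u : Fˣ) : MulAut (Multiplicative F) where
  toFun x := Multiplicative.ofAdd ((u : F) * x.toAdd)
  invFun x := Multiplicative.ofAdd (((u⁻¹ : Fˣ) : F) * x.toAdd)
  left_inv x := by simp
  right_inv x := by simp
  map_mul' x y := by simp [mul_add]

/-- The group `K = ⟨ρ⟩` of automorphisms of the additive group of `F` generated by
`ρ : x ↦ ω ^ e * x`. -/
abbrev scalingGroup {F : Type*} [Field F] (ω : Fˣ) (e : ℕ) : Subgroup (MulAut (Multiplicative F)) :=
  Subgroup.zpowers (scaling (ω ^ e))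

/-- The semidirect product `H ⋊ K` of the additive group `H` of `F` by the automorphism group
`K = ⟨x ↦ ω ^ e * x⟩`, with the tautological action of `K` on `H`. -/
abbrev CyclotomicGroup {F : Type*} [Field F] (ω : Fˣ) (e : ℕ) : Type _ :=
  SemidirectProduct (Multiplicative F) (scalingGroup ω e) (scalingGroup ω e).subtype

/-- The subset `(-1 + D, K) = {(-1 + d, φ) | d ∈ D, φ ∈ K}` of `H ⋊ K`. -/
def shiftedSet {F : Type*} [Field F] (ω : Fˣ) (e : ℕ) (D : Set F) : Set (CyclotomicGroup ω e) :=
  {g | ∃ d ∈ D, g.left = Multiplicative.ofAdd (-1 + d)}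

/-!
Let `χ` be the quartic character of `F = 𝔽_p` with values in the Gaussian integers and
`χ ω = i`, so that `C₀ = {χ = 1}` and `C₂ = {χ = -1}`. An element `(h, φ)` of `H ⋊ K` is determined
by the pair `(h, u)` with `u = φ 1 ∈ C₀`, and there is an arc from `(h, u)` to `(h', u')` iff
`χ (h' - h + u) = -1` (`adj_iff_coords`). Hence the two-step paths from `(h, u)` to `(h', u')`
pass through the `(k, v)` with `χ (k - h + u) = -1`, `χ v = 1` and `χ (h' - k + v) = -1`. If the
number of `v ∈ C₀` with `w + v ∈ C₂` has the same value `c` for every `w ≠ 0` (for `w = 0` there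
are none), the number of paths is `c` times the number of admissible `k ≠ h'`, which is `|C₂| - 1`
or `|C₂|` according to whether there is an arc from `(h, u)` to `(h', u')`; this is the strong
regularity (`isDSRGWith_of_card`).

Constancy of `c` is a fact about cyclotomic numbers of order four. After dividing by `w + v`, it
says that `#{x | χ x = z, χ (1 - x) = -1}` does not depend on the fourth root of unity `z`. The
involution `x ↦ x / (x - 1)` exchanges `z` and `-z` (`card_pairs_neg`), and equality between the
classes `z = ± 1` and `z = ± i` amounts to `Re J(χ, χ²) = -1`, where `J` is the Jacobi sum
(`sum_quadratic_ite`). This is where `p = 1 + 4 t²` enters: `J(χ, χ²) = a + b i` has norm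
`a² + b² = p`, a congruence gives `a ≡ -1` modulo `4` (`re_jacobiSum_modEq`), and the
representation of a prime as a sum of two squares is unique, so `a = -1`
(`eq_neg_one_of_sq_add_sq`).
-/

open Finset

local notation "ℤ[i]" => GaussianInt

/-! ### Quartic characters with values in the Gaussian integers -/

section Quartic

variable {F : Type*} [Field F]

theorem GaussianInt.pow_four_eq_one {z : ℤ[i]} (hz : z ^ 4 = 1) :
    z = 1 ∨ z = -1 ∨ z = ⟨0, 1⟩ ∨ z = ⟨0, -1⟩ := by
  have h : (z - 1) * ((z + 1) * ((z - ⟨0, 1⟩) * (z - ⟨0, -1⟩))) = 0 := by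
    have h1 : (z - ⟨0, 1⟩) * (z - ⟨0, -1⟩) = z ^ 2 + 1 := by
      ext <;> simp [pow_two] <;> ring
    rw [h1]
    linear_combination hz
  rcases mul_eq_zero.mp h with h | h
  · exact Or.inl (sub_eq_zero.mp h)
  rcases mul_eq_zero.mp h with h | h
  · exact Or.inr (Or.inl (eq_neg_of_add_eq_zero_left h))
  rcases mul_eq_zero.mp h with h | h
  · exact Or.inr (Or.inr (Or.inl (sub_eq_zero.mp h)))
  · exact Or.inr (Or.inr (Or.inr (sub_eq_zero.mp h)))

theorem MulChar.apply_pow_four {χ : MulChar F ℤ[i]} (h4 : χ ^ 4 = 1) {x : F} (hx : x ≠ 0) :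
    χ x ^ 4 = 1 := by
  rw [← MulChar.pow_apply' χ (by norm_num), h4, MulChar.one_apply (isUnit_iff_ne_zero.mpr hx)]

theorem MulChar.quartic_cases {χ : MulChar F ℤ[i]} (h4 : χ ^ 4 = 1) (x : F) :
    x = 0 ∧ χ x = 0 ∨ χ x = 1 ∨ χ x = -1 ∨ χ x = ⟨0, 1⟩ ∨ χ x = ⟨0, -1⟩ := by
  rcases eq_or_ne x 0 with rfl | hx
  · exact Or.inl ⟨rfl, χ.map_zero⟩
  · exact Or.inr (GaussianInt.pow_four_eq_one (MulChar.apply_pow_four h4 hx))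

theorem MulChar.ne_zero_of_apply {χ : MulChar F ℤ[i]} {x : F} {z : ℤ[i]} (hx : χ x = z)
    (hz : z ≠ 0) : x ≠ 0 := by
  rintro rfl
  exact hz (hx ▸ χ.map_zero)

theorem quadratic_inv {χ : MulChar F ℤ[i]} (h4 : χ ^ 4 = 1) : (χ ^ 2)⁻¹ = χ ^ 2 := by
  rw [inv_eq_iff_mul_eq_one, ← pow_add, h4]

/-! ### The Jacobi sum `J(χ, χ²)` of a quartic character -/

variable [Fintype F]

/-- The Jacobi sum `J(χ, χ²)` has norm `|F|`. Characters are pushed forward to `ℂ`, where the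
Jacobi sum of the inverse characters is the complex conjugate. -/
theorem norm_jacobiSum_sq {χ : MulChar F ℤ[i]} (h4 : χ ^ 4 = 1) (h2 : χ ^ 2 ≠ 1) :
    (jacobiSum χ (χ ^ 2)).re ^ 2 + (jacobiSum χ (χ ^ 2)).im ^ 2 = Fintype.card F := by
  set f := GaussianInt.toComplex
  have hf : Function.Injective f := GaussianInt.toComplex_injective
  have hne {ψ : MulChar F ℤ[i]} (h : ψ ≠ 1) : ψ.ringHomComp f ≠ 1 :=
    (MulChar.ringHomComp_ne_one_iff hf).mpr h
  have h1 : χ ≠ 1 := fun h ↦ h2 (by rw [h, one_pow])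
  have h3 : χ * χ ^ 2 ≠ 1 := fun h ↦ h1 (by
    have : χ ^ 4 = χ * (χ * χ ^ 2) := by rw [← pow_succ', ← pow_succ']
    rw [← h4, this, h, mul_one])
  have hF : ringChar ℂ ≠ ringChar F := by
    rw [ringChar.eq_zero]
    exact (CharP.ringChar_ne_zero_of_finite F).symm
  have hinv (ψ : MulChar F ℤ[i]) (hψ : ψ ^ 4 = 1) :
      (ψ.ringHomComp f)⁻¹ = ψ.ringHomComp ((starRingEnd ℂ).comp f) := by
    ext x
    rw [MulChar.inv_apply_eq_inv']
    have hx := MulChar.apply_pow_four hψ x.ne_zero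
    simp only [MulChar.ringHomComp_apply, RingHom.comp_apply]
    rcases GaussianInt.pow_four_eq_one hx with h | h | h | h <;>
      simp [h, f, GaussianInt.toComplex_def]
  have hφ : (χ ^ 2) ^ 4 = 1 := by rw [← pow_mul, mul_comm, pow_mul, h4, one_pow]
  have key := jacobiSum_mul_jacobiSum_inv hF (hne h1) (hne h2)
    (by rw [← MulChar.ringHomComp_mul]; exact hne h3)
  rw [hinv χ h4, hinv _ hφ, jacobiSum_ringHomComp, jacobiSum_ringHomComp, RingHom.comp_apply,
    Complex.mul_conj, ← GaussianInt.intCast_complex_norm] at key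
  have key' : (jacobiSum χ (χ ^ 2)).norm = Fintype.card F := by exact_mod_cast key
  rw [← key', Zsqrtd.norm_def]
  ring

theorem jacobiSum_quadratic {χ : MulChar F ℤ[i]} (h4 : χ ^ 4 = 1) (h2 : χ ^ 2 ≠ 1)
    (hneg : χ (-1) = 1) : jacobiSum (χ ^ 2) (χ ^ 2) = -1 := by
  have h := jacobiSum_nontrivial_inv h2
  rwa [quadratic_inv h4, MulChar.pow_apply' _ two_ne_zero, hneg, one_pow] at h

theorem GaussianInt.re_sum {ι : Type*} (s : Finset ι) (g : ι → ℤ[i]) :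
    (∑ i ∈ s, g i).re = ∑ i ∈ s, (g i).re :=
  map_sum (⟨⟨Zsqrtd.re, rfl⟩, fun _ _ ↦ rfl⟩ : ℤ[i] →+ ℤ) g s

theorem sum_sub_one_mul_sub_one (χ ψ : MulChar F ℤ[i]) (hχ : χ ≠ 1) (hψ : ψ ≠ 1) :
    ∑ x : F, (χ x - 1) * (ψ (1 - x) - 1) = jacobiSum χ ψ + Fintype.card F := by
  have h1 : ∑ x : F, ψ (1 - x) = 0 := by
    rw [← MulChar.sum_eq_zero_of_ne_one hψ]
    exact (Equiv.subLeft (1 : F)).sum_comp (fun x ↦ ψ x)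
  simp only [sub_mul, mul_sub, sum_sub_distrib, one_mul, mul_one, h1, jacobiSum,
    MulChar.sum_eq_zero_of_ne_one hχ]
  simp

/-- The terms of `J(χ, χ²) + |F| = ∑ (χ x - 1) (χ² (1 - x) - 1)` and
`|F| - 1 = ∑ (χ² x - 1) (χ² (1 - x) - 1)` satisfy, one by one, that twice the real part of the
first is congruent to the second modulo `8`. -/
theorem re_jacobiSum_modEq {χ : MulChar F ℤ[i]} (h4 : χ ^ 4 = 1) (h2 : χ ^ 2 ≠ 1)
    (hneg : χ (-1) = 1) :
    (8 : ℤ) ∣ 2 * ((jacobiSum χ (χ ^ 2)).re + Fintype.card F) - (Fintype.card F - 1) := by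
  have h1 : χ ≠ 1 := fun h ↦ h2 (by rw [h, one_pow])
  have ha := congrArg Zsqrtd.re (sum_sub_one_mul_sub_one χ (χ ^ 2) h1 h2)
  have hb := congrArg Zsqrtd.re (sum_sub_one_mul_sub_one (χ ^ 2) (χ ^ 2) h2 h2)
  rw [jacobiSum_quadratic h4 h2 hneg, GaussianInt.re_sum] at hb
  rw [GaussianInt.re_sum] at ha
  simp only [Zsqrtd.re_add, Zsqrtd.re_natCast, Zsqrtd.re_neg, Zsqrtd.re_one] at ha hb
  have hb' : (Fintype.card F : ℤ) - 1 = -1 + Fintype.card F := by ring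
  rw [hb', ← ha, ← hb, mul_sum, ← sum_sub_distrib]
  refine dvd_sum fun x _ ↦ ?_
  simp only [MulChar.pow_apply' _ two_ne_zero]
  rcases MulChar.quartic_cases h4 x with ⟨rfl, -⟩ | h | h | h | h
  · simp
  all_goals
    rcases MulChar.quartic_cases h4 (1 - x) with ⟨h0, -⟩ | h' | h' | h' | h'
    · obtain rfl : x = 1 := (sub_eq_zero.mp h0).symm
      simp
    all_goals
      rw [h, h']
      decide

/-- A case of the uniqueness of the representation of a prime as a sum of two squares, with the
sign of the odd square root fixed by a congruence modulo `4`. -/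
theorem eq_neg_one_of_sq_add_sq {p : ℕ} (hpp : p.Prime) {t a b : ℤ}
    (hp : (p : ℤ) = 1 + 4 * t ^ 2) (hab : a ^ 2 + b ^ 2 = p) (ha : (4 : ℤ) ∣ a + 1) : a = -1 := by
  have hpZ : Prime (p : ℤ) := Nat.prime_iff_prime_int.mp hpp
  have hp0 : (0 : ℤ) < p := by exact_mod_cast hpp.pos
  obtain ⟨c, hc⟩ := ha
  have hb : Even b := by
    by_contra hb
    obtain ⟨d, rfl⟩ := Int.not_even_iff_odd.mp hb
    have : (4 * c - 1) ^ 2 + (2 * d + 1) ^ 2 = 1 + 4 * t ^ 2 := by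
      rw [← hp, ← hab, ← hc]; ring
    ring_nf at this
    omega
  suffices h : a ^ 2 = 1 by
    rcases mul_self_eq_one_iff.mp (sq a ▸ h) with h | h <;> omega
  have key (d : ℤ) (hd : (p : ℤ) = 1 + d ^ 2) (hdvd : (p : ℤ) ∣ a * d - b) : a ^ 2 = 1 := by
    obtain ⟨m, hm⟩ := hdvd
    -- Brahmagupta's identity for `(a ^ 2 + b ^ 2) * (1 + d ^ 2)`: since `a * d - b = p * m`, either
    -- `m = 0`, or `a + b * d = 0` and then `b ^ 2 = 1`, against the parity of `b`.
    have h1 : (a + b * d) ^ 2 + (p * m) ^ 2 = p ^ 2 := by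
      rw [← hm]
      linear_combination (1 + d ^ 2) * hab - (p : ℤ) * hd
    have hp0' : (p : ℤ) ≠ 0 := hp0.ne'
    rcases eq_or_ne m 0 with rfl | hm0
    · have hbd : b = a * d := by linarith
      subst hbd
      refine mul_right_cancel₀ hp0' ?_
      linear_combination hab + a ^ 2 * hd
    · exfalso
      have hm1 : 1 ≤ m ^ 2 := Int.add_one_le_iff.mpr (Even.pow_pos even_two hm0)
      have h0 : (a + b * d) ^ 2 = 0 := by nlinarith [sq_nonneg (a + b * d), mul_pos hp0 hp0]
      have h0' : a = -(b * d) := eq_neg_of_add_eq_zero_left (pow_eq_zero_iff two_ne_zero |>.mp h0)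
      have hb1 : b ^ 2 = 1 := by
        refine mul_right_cancel₀ hp0' ?_
        rw [h0'] at hab
        linear_combination hab + b ^ 2 * hd
      exact Int.not_even_one (hb1 ▸ (hb.pow_of_ne_zero two_ne_zero))
  have hdvd : (p : ℤ) ∣ (a * (2 * t) - b) * (a * (-(2 * t)) - b) :=
    ⟨1 - a ^ 2, by linear_combination hab + a ^ 2 * hp⟩
  rcases hpZ.dvd_or_dvd hdvd with h | h
  · exact key _ (by rw [hp]; ring) h
  · exact key _ (by rw [hp]; ring) h

/-! ### Cyclotomic numbers of order four -/

/-- The cosets `{χ = 1}` and `{χ = -1}` have `(|F| - 1) / 4` elements, by the expansion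
`4 [χ x = z] = [x ≠ 0] + 2 Re (z χ x) + χ² x` of their indicators for `z = ± 1`. -/
theorem card_filter_apply_eq (χ : MulChar F ℤ[i]) (h4 : χ ^ 4 = 1) (h2 : χ ^ 2 ≠ 1) {z : ℤ[i]}
    (hz : z = 1 ∨ z = -1) : 4 * (#{x | χ x = z} : ℤ) = Fintype.card F - 1 := by
  classical
  have h1 : χ ≠ 1 := fun h ↦ h2 (by rw [h, one_pow])
  have hp (x : F) : 4 * (if χ x = z then 1 else 0 : ℤ) =
      (1 - if x = 0 then 1 else 0) + 2 * (z * χ x).re + ((χ ^ 2) x).re := by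
    rw [MulChar.pow_apply' _ two_ne_zero]
    rcases eq_or_ne x 0 with rfl | hx
    · have h0 : χ 0 = 0 := χ.map_zero
      rcases hz with rfl | rfl <;> simp [h0]
    · rcases GaussianInt.pow_four_eq_one (MulChar.apply_pow_four h4 hx) with h | h | h | h <;>
      rcases hz with rfl | rfl <;> simp only [h, hx] <;> decide
  rw [card_filter, Nat.cast_sum, mul_sum]
  push_cast
  simp only [hp, sum_add_distrib, ← mul_sum, ← GaussianInt.re_sum, MulChar.sum_eq_zero_of_ne_one h1,
    MulChar.sum_eq_zero_of_ne_one h2, sum_sub_distrib]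
  simp

/-- The involution `x ↦ x / (x - 1)` exchanges the two sets: it sends `1 - x` to `(1 - x)⁻¹`, and
`χ (x - 1) = χ (1 - x) = -1` on both. -/
theorem card_pairs_neg {χ : MulChar F ℤ[i]} (hneg : χ (-1) = 1) (z : ℤ[i]) :
    #{x | χ x = z ∧ χ (1 - x) = -1} = #{x | χ x = -z ∧ χ (1 - x) = -1} := by
  have key (w : ℤ[i]) (x : F) (hx : χ x = w ∧ χ (1 - x) = -1) :
      x - 1 ≠ 0 ∧ χ (x / (x - 1)) = -w ∧ χ (1 - x / (x - 1)) = -1 := by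
    obtain ⟨h1, h2⟩ := hx
    have h0 : 1 - x ≠ 0 := MulChar.ne_zero_of_apply h2 (by decide)
    have h0' : x - 1 ≠ 0 := by rwa [← neg_sub, neg_ne_zero]
    have h3 : χ (x - 1) = -1 := by
      rw [show x - 1 = -1 * (1 - x) by ring, map_mul, hneg, h2, one_mul]
    have h4 : χ (x - 1)⁻¹ = -1 := by
      have := congrArg χ (inv_mul_cancel₀ h0')
      rw [map_mul, h3, map_one] at this
      linear_combination -this
    refine ⟨h0', by rw [div_eq_mul_inv, map_mul, h4, h1]; ring, ?_⟩
    have : 1 - x / (x - 1) = (-1) * (x - 1)⁻¹ := by field_simp; ring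
    rw [this, map_mul, hneg, h4, one_mul]
  have inv (x : F) (hx : x - 1 ≠ 0) : x / (x - 1) / (x / (x - 1) - 1) = x := by
    have : x / (x - 1) - 1 = (x - 1)⁻¹ := by field_simp; ring
    rw [this]
    field_simp
  refine card_nbij' (fun x ↦ x / (x - 1)) (fun x ↦ x / (x - 1)) ?_ ?_ ?_ ?_
  · intro x hx
    simpa using (key z x (by simpa using hx)).2
  · intro x hx
    simpa using (key (-z) x (by simpa using hx)).2
  · intro x hx
    exact inv x (key z x (by simpa using hx)).1
  · intro x hx
    exact inv x (key (-z) x (by simpa using hx)).1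

/-- The expansion `4 [χ y = -1] = [y ≠ 0] - 2 Re (χ y) + χ² y` at `y = 1 - x` turns four times the
sum into `-1 - 2 Re J(χ, χ²) + J(χ², χ²)`. -/
theorem sum_quadratic_ite {χ : MulChar F ℤ[i]} (h4 : χ ^ 4 = 1) (h2 : χ ^ 2 ≠ 1)
    (hneg : χ (-1) = 1) (hJ : (jacobiSum χ (χ ^ 2)).re = -1) :
    ∑ x : F, ((χ ^ 2) x).re * (if χ (1 - x) = -1 then 1 else 0 : ℤ) = 0 := by
  classical
  have hp (x : F) : 4 * (((χ ^ 2) x).re * (if χ (1 - x) = -1 then 1 else 0 : ℤ)) =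
      ((χ ^ 2) x).re - (if x = 1 then 1 else 0) - 2 * ((χ ^ 2) x * χ (1 - x)).re
        + ((χ ^ 2) x * (χ ^ 2) (1 - x)).re := by
    have h0 : χ 0 = 0 := χ.map_zero
    simp only [MulChar.pow_apply' _ two_ne_zero]
    rcases eq_or_ne x 1 with rfl | hx
    · simp [h0]
    rcases MulChar.quartic_cases h4 x with ⟨rfl, -⟩ | h | h | h | h
    · simp [h0]
    all_goals
      have hx' : 1 - x ≠ 0 := sub_ne_zero.mpr hx.symm
      rcases GaussianInt.pow_four_eq_one (MulChar.apply_pow_four h4 hx') with h' | h' | h' | h' <;>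
      simp only [h, h', hx] <;> decide
  have h0 : 4 * ∑ x : F, ((χ ^ 2) x).re * (if χ (1 - x) = -1 then 1 else 0 : ℤ) = 0 := by
    rw [mul_sum]
    simp only [hp, sum_add_distrib, sum_sub_distrib, ← mul_sum, ← GaussianInt.re_sum]
    rw [MulChar.sum_eq_zero_of_ne_one h2, ← jacobiSum, ← jacobiSum, jacobiSum_comm (χ ^ 2) χ, hJ,
      jacobiSum_quadratic h4 h2 hneg]
    simp
  omega

/-- The cyclotomic numbers `#{x | χ x = z, χ (1 - x) = -1}` all equal `(|F| - 1) / 16`. -/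
theorem card_pairs {χ : MulChar F ℤ[i]} (h4 : χ ^ 4 = 1) (h2 : χ ^ 2 ≠ 1)
    (hneg : χ (-1) = 1) (hJ : (jacobiSum χ (χ ^ 2)).re = -1) {z : ℤ[i]} (hz : z ^ 4 = 1) :
    16 * (#{x | χ x = z ∧ χ (1 - x) = -1} : ℤ) = Fintype.card F - 1 := by
  -- For `x ≠ 0` both `χ² x` and `z²` are signs, and they agree iff `χ x = ± z`.
  have hp (x : F) : 2 * ((if χ x = z ∧ χ (1 - x) = -1 then 1 else 0 : ℤ) +
      (if χ x = -z ∧ χ (1 - x) = -1 then 1 else 0 : ℤ)) =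
      (if χ (1 - x) = -1 then 1 else 0 : ℤ) +
        (z ^ 2).re * (((χ ^ 2) x).re * (if χ (1 - x) = -1 then 1 else 0 : ℤ)) := by
    rw [MulChar.pow_apply' _ two_ne_zero]
    by_cases h' : χ (1 - x) = -1
    · simp only [h', and_true]
      rcases MulChar.quartic_cases h4 x with ⟨rfl, -⟩ | h | h | h | h
      · simp only [sub_zero, map_one] at h'
        exact absurd h' (by decide)
      all_goals
        rcases GaussianInt.pow_four_eq_one hz with rfl | rfl | rfl | rfl <;>
        simp only [h] <;> decide
    · simp [h']
  have hs : ∑ x : F, (if χ (1 - x) = -1 then 1 else 0 : ℤ) = #{x | χ x = -1} := by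
    rw [card_filter]
    push_cast
    exact (Equiv.subLeft (1 : F)).sum_comp (fun x ↦ (if χ x = -1 then 1 else 0 : ℤ))
  have hsum := sum_congr rfl fun x (_ : x ∈ (univ : Finset F)) ↦ hp x
  rw [← mul_sum, sum_add_distrib, sum_add_distrib, ← mul_sum, sum_quadratic_ite h4 h2 hneg hJ,
    hs] at hsum
  have hA := card_pairs_neg hneg z
  rw [card_filter, card_filter] at hA
  have hA' := congrArg (Nat.cast : ℕ → ℤ) hA
  push_cast at hA'
  have := card_filter_apply_eq χ h4 h2 (z := -1) (Or.inr rfl)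
  rw [card_filter]
  push_cast
  linarith

/-- The substitution `x = w / (w + u)` gives `χ x = -χ w` and `χ (1 - x) = -1`, which reduces the
count to `card_pairs`. -/
theorem card_shift {χ : MulChar F ℤ[i]} (h4 : χ ^ 4 = 1) (h2 : χ ^ 2 ≠ 1)
    (hneg : χ (-1) = 1) (hJ : (jacobiSum χ (χ ^ 2)).re = -1) {w : F} (hw : w ≠ 0) :
    16 * (#{u | χ u = 1 ∧ χ (w + u) = -1} : ℤ) = Fintype.card F - 1 := by
  have hζ : (-χ w) ^ 4 = 1 := by rw [← MulChar.apply_pow_four h4 hw]; ring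
  have hζ0 : -χ w ≠ 0 := fun h ↦ by simp [h] at hζ
  rw [← card_pairs h4 h2 hneg hJ hζ]
  congr 2
  have hinv {y : F} {ζ : ℤ[i]} (hy : y ≠ 0) (h : χ y = ζ) : ζ * χ y⁻¹ = 1 := by
    rw [← h, ← map_mul, mul_inv_cancel₀ hy, map_one]
  refine card_nbij' (fun u ↦ w / (w + u)) (fun x ↦ w / x - w) ?_ ?_ ?_ ?_
  · intro u hu
    simp only [coe_filter, mem_univ, true_and, Set.mem_ofPred_eq] at hu ⊢
    have h0 : w + u ≠ 0 := MulChar.ne_zero_of_apply hu.2 (by decide)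
    have h1 := hinv h0 hu.2
    have h2 : 1 - w / (w + u) = u * (w + u)⁻¹ := by field_simp; ring
    rw [h2, div_eq_mul_inv, map_mul, map_mul, hu.1]
    exact ⟨by linear_combination -χ w * h1, by linear_combination -h1⟩
  · intro x hx
    simp only [coe_filter, mem_univ, true_and, Set.mem_ofPred_eq] at hx ⊢
    have h0 : x ≠ 0 := MulChar.ne_zero_of_apply hx.1 hζ0
    have h1 := hinv h0 hx.1
    have h2 : w / x - w = w * x⁻¹ * (1 - x) := by field_simp
    have h3 : w + (w / x - w) = w * x⁻¹ := by field_simp; ring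
    rw [h3, h2]
    simp only [map_mul, hx.2]
    exact ⟨by linear_combination h1, by linear_combination -h1⟩
  · intro u hu
    simp only [coe_filter, mem_univ, true_and, Set.mem_ofPred_eq] at hu
    have h0 : w + u ≠ 0 := MulChar.ne_zero_of_apply hu.2 (by decide)
    field_simp
    ring
  · intro x hx
    simp only [coe_filter, mem_univ, true_and, Set.mem_ofPred_eq] at hx
    have h0 : x ≠ 0 := MulChar.ne_zero_of_apply hx.1 hζ0
    field_simp
    ring

end Quartic

/-! ### Coordinates on the semidirect product -/

section Cosets

variable {F : Type*} [Field F] {ω : Fˣ} {χ : MulChar F ℤ[i]}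

theorem exists_eq_pow_mul_of_generator (hω : ∀ x : Fˣ, x ∈ Subgroup.zpowers ω) (u : Fˣ) :
    ∃ r < 4, ∃ y ∈ Subgroup.zpowers (ω ^ 4), u = ω ^ r * y := by
  obtain ⟨n, rfl⟩ := Subgroup.mem_zpowers_iff.mp (hω u)
  refine ⟨(n % 4).toNat, by omega, (ω ^ 4) ^ (n / 4), Subgroup.zpow_mem_zpowers _ _, ?_⟩
  rw [← zpow_natCast ω (n % 4).toNat, Int.toNat_of_nonneg (by omega), ← zpow_natCast ω 4,
    ← zpow_mul, ← zpow_add]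
  congr 1
  push_cast
  omega

theorem MulChar.apply_eq_one_of_mem_zpowers (hχ : χ ω = ⟨0, 1⟩) {y : Fˣ}
    (hy : y ∈ Subgroup.zpowers (ω ^ 4)) : χ y = 1 := by
  have h : Subgroup.zpowers (ω ^ 4) ≤ χ.toUnitHom.ker := by
    rw [Subgroup.zpowers_le, MonoidHom.mem_ker]
    ext1
    rw [MulChar.coe_toUnitHom, Units.val_pow_eq_pow_val, map_pow, hχ]
    decide
  rw [← MulChar.coe_toUnitHom, h hy, Units.val_one]

theorem MulChar.apply_pow_mul_of_mem_zpowers (hχ : χ ω = ⟨0, 1⟩) {y : Fˣ}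
    (hy : y ∈ Subgroup.zpowers (ω ^ 4)) (r : ℕ) :
    χ ((ω ^ r * y : Fˣ) : F) = (⟨0, 1⟩ : ℤ[i]) ^ r := by
  rw [Units.val_mul, map_mul, MulChar.apply_eq_one_of_mem_zpowers hχ hy, mul_one,
    Units.val_pow_eq_pow_val, map_pow, hχ]

theorem mem_zpowers_pow_four_iff (hω : ∀ x : Fˣ, x ∈ Subgroup.zpowers ω) (hχ : χ ω = ⟨0, 1⟩)
    (u : Fˣ) : u ∈ Subgroup.zpowers (ω ^ 4) ↔ χ u = 1 := by
  refine ⟨MulChar.apply_eq_one_of_mem_zpowers hχ, fun h ↦ ?_⟩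
  obtain ⟨r, hr, y, hy, rfl⟩ := exists_eq_pow_mul_of_generator hω u
  rw [MulChar.apply_pow_mul_of_mem_zpowers hχ hy] at h
  interval_cases r
  · simpa using hy
  all_goals exact absurd h (by decide)

theorem mem_cyclotomicCoset_two_iff (hω : ∀ x : Fˣ, x ∈ Subgroup.zpowers ω)
    (hχ : χ ω = ⟨0, 1⟩) (x : F) : x ∈ cyclotomicCoset ω 4 2 ↔ χ x = -1 := by
  constructor
  · rintro ⟨y, hy, rfl⟩
    rw [MulChar.apply_pow_mul_of_mem_zpowers hχ hy]
    decide
  · intro h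
    lift x to Fˣ using isUnit_iff_ne_zero.mpr (MulChar.ne_zero_of_apply h (by decide))
    obtain ⟨r, hr, y, hy, rfl⟩ := exists_eq_pow_mul_of_generator hω x
    rw [MulChar.apply_pow_mul_of_mem_zpowers hχ hy] at h
    have : r = 2 := by
      interval_cases r
      all_goals first | rfl | exact absurd h (by decide)
    subst this
    exact ⟨y, hy, rfl⟩

/-- `scaling` as a group homomorphism. -/
def scalingHom (F : Type*) [Field F] : Fˣ →* MulAut (Multiplicative F) where
  toFun := scaling
  map_one' := by ext x; simp [scaling]
  map_mul' u v := by ext x; simp [scaling, mul_assoc]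

theorem mem_scalingGroup_iff {e : ℕ} {φ : MulAut (Multiplicative F)} :
    φ ∈ scalingGroup ω e ↔ ∃ u ∈ Subgroup.zpowers (ω ^ e), scaling u = φ := by
  change φ ∈ Subgroup.zpowers (scalingHom F (ω ^ e)) ↔ _
  rw [← MonoidHom.map_zpowers, Subgroup.mem_map]
  rfl

/-- The pair `(h, φ 1)` of field elements that determines an element `(h, φ)` of `H ⋊ K`. -/
def CyclotomicGroup.coords {e : ℕ} (g : CyclotomicGroup ω e) : F × F :=
  (g.left.toAdd, (g.right.1 (Multiplicative.ofAdd 1)).toAdd)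

open CyclotomicGroup

theorem exists_scaling_eq_right {e : ℕ} (g : CyclotomicGroup ω e) :
    ∃ u ∈ Subgroup.zpowers (ω ^ e), scaling u = g.right.1 ∧ (coords g).2 = u := by
  obtain ⟨u, hu, h⟩ := mem_scalingGroup_iff.mp g.right.2
  exact ⟨u, hu, h, by simp [coords, ← h, scaling]⟩

theorem coords_injective (e : ℕ) : Function.Injective (coords (ω := ω) (e := e)) := by
  intro g g' h
  obtain ⟨u, -, hu, hu'⟩ := exists_scaling_eq_right g
  obtain ⟨v, -, hv, hv'⟩ := exists_scaling_eq_right g'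
  have huv : u = v := by
    ext
    rw [← hu', ← hv', h]
  refine SemidirectProduct.ext ?_ (Subtype.ext ?_)
  · exact congrArg (fun q : F × F ↦ Multiplicative.ofAdd q.1) h
  · rw [← hu, ← hv, huv]

theorem mem_range_coords_iff (hω : ∀ x : Fˣ, x ∈ Subgroup.zpowers ω) (hχ : χ ω = ⟨0, 1⟩)
    (q : F × F) : q ∈ Set.range (coords (ω := ω) (e := 4)) ↔ χ q.2 = 1 := by
  constructor
  · rintro ⟨g, rfl⟩
    obtain ⟨u, hu, -, h⟩ := exists_scaling_eq_right g
    rw [h]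
    exact MulChar.apply_eq_one_of_mem_zpowers hχ hu
  · obtain ⟨h, u⟩ := q
    intro hq
    dsimp only at hq
    lift u to Fˣ using isUnit_iff_ne_zero.mpr (MulChar.ne_zero_of_apply hq (by decide))
    refine ⟨⟨Multiplicative.ofAdd h, ⟨scaling u, mem_scalingGroup_iff.mpr
      ⟨u, (mem_zpowers_pow_four_iff hω hχ u).mpr hq, rfl⟩⟩⟩, ?_⟩
    simp [coords, scaling]

theorem adj_iff_coords (hω : ∀ x : Fˣ, x ∈ Subgroup.zpowers ω) (hχ : χ ω = ⟨0, 1⟩)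
    (x y : CyclotomicGroup ω 4) :
    (cayleyDigraph (shiftedSet ω 4 (cyclotomicCoset ω 4 2))).Adj x y ↔
      χ ((coords y).1 - (coords x).1 + (coords x).2) = -1 := by
  obtain ⟨u, hu, hux, hu'⟩ := exists_scaling_eq_right x
  have hleft : (x⁻¹ * y).left =
      Multiplicative.ofAdd (((u⁻¹ : Fˣ) : F) * ((coords y).1 - (coords x).1)) := by
    have h1 : (x⁻¹ * y).left = (x.right.1)⁻¹ (x.left⁻¹ * y.left) := by
      rw [map_mul]
      rfl
    rw [h1, ← hux, mul_comm x.left⁻¹, ← div_eq_mul_inv]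
    rfl
  have hd : (((u⁻¹ : Fˣ) : F) * ((coords y).1 - (coords x).1) : F) + 1 =
      ((u⁻¹ : Fˣ) : F) * ((coords y).1 - (coords x).1 + u) := by
    rw [mul_add _ _ (u : F), Units.inv_mul]
  have h1 : χ ((coords y).1 - (coords x).1 + u) =
      χ (((u⁻¹ : Fˣ) : F) * ((coords y).1 - (coords x).1) + 1) := by
    rw [hd, map_mul, MulChar.apply_eq_one_of_mem_zpowers hχ (inv_mem hu), one_mul]
  rw [hu', h1, ← mem_cyclotomicCoset_two_iff hω hχ]
  change (∃ d ∈ _, (x⁻¹ * y).left = _) ↔ _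
  rw [hleft]
  constructor
  · rintro ⟨d, hd, h⟩
    have h' := Multiplicative.ofAdd.injective h
    rwa [h', neg_add_cancel_comm]
  · intro h
    exact ⟨_, h, by rw [add_comm _ (1 : F), neg_add_cancel_left]⟩

end Cosets

/-! ### Counting in the Cayley digraph -/

section Graph

variable {F : Type*} [Field F] [Fintype F] {ω : Fˣ} {χ : MulChar F ℤ[i]}

open CyclotomicGroup

theorem ncard_coords (hω : ∀ x : Fˣ, x ∈ Subgroup.zpowers ω) (hχ : χ ω = ⟨0, 1⟩)
    (P : F × F → Prop) [DecidablePred P] :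
    {g : CyclotomicGroup ω 4 | P (coords g)}.ncard = #{q : F × F | χ q.2 = 1 ∧ P q} := by
  rw [← Set.ncard_image_of_injective _ (coords_injective 4), ← Set.ncard_coe_finset]
  congr 1
  ext q
  simp only [coe_filter, mem_univ, true_and, Set.mem_ofPred_eq, ← mem_range_coords_iff hω hχ q]
  constructor
  · rintro ⟨g, hg, rfl⟩
    exact ⟨⟨g, rfl⟩, hg⟩
  · rintro ⟨⟨g, rfl⟩, hg⟩
    exact ⟨g, hg, rfl⟩

theorem card_filter_add_const (a : F) :
    #{x | χ (x + a) = -1} = #{x | χ x = -1} :=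
  card_equiv (Equiv.addRight a) (by simp)

/-- The count of two-step paths in coordinates: `k = b` is excluded as the first coordinate of the
middle vertex, and every other admissible `k` contributes `c`. -/
theorem card_two_paths [DecidableEq F] {c : ℕ}
    (hc : ∀ w : F, w ≠ 0 → #{u | χ u = 1 ∧ χ (w + u) = -1} = c) (a b : F) :
    #{q : F × F | χ q.2 = 1 ∧ χ (q.1 + a) = -1 ∧ χ (b - q.1 + q.2) = -1} =
      c * (#{x | χ x = -1} - if χ (b + a) = -1 then 1 else 0) := by
  have h0 : #{u : F | χ u = 1 ∧ χ (0 + u) = -1} = 0 := by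
    rw [card_eq_zero, filter_eq_empty_iff]
    rintro u - ⟨h1, h2⟩
    rw [zero_add, h1] at h2
    exact absurd h2 (by decide)
  have hfib (k : F) (hk : k ∈ ({k | χ (k + a) = -1} : Finset F).erase b) :
      #{q ∈ ({q : F × F | χ q.2 = 1 ∧ χ (q.1 + a) = -1 ∧ χ (b - q.1 + q.2) = -1} : Finset _)
        | q.1 = k} = c := by
    rw [mem_erase, mem_filter] at hk
    rw [← hc (b - k) (sub_ne_zero.mpr hk.1.symm)]
    refine card_nbij' Prod.snd (fun u ↦ (k, u)) ?_ ?_ ?_ ?_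
    · rintro ⟨k', u⟩ hq
      simp only [coe_filter, mem_filter, mem_univ, true_and, Set.mem_ofPred_eq] at hq ⊢
      obtain ⟨⟨h1, -, h2⟩, rfl⟩ := hq
      exact ⟨h1, h2⟩
    · intro u hu
      simp only [coe_filter, mem_filter, mem_univ, true_and, Set.mem_ofPred_eq, and_true] at hu ⊢
      exact ⟨hu.1, hk.2.2, hu.2⟩
    · rintro ⟨k', u⟩ hq
      simp only [coe_filter, mem_filter, mem_univ, true_and, Set.mem_ofPred_eq] at hq ⊢
      rw [hq.2]
    · intro u _
      rfl
  rw [card_eq_sum_card_fiberwise (f := Prod.fst)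
    (t := ({k | χ (k + a) = -1} : Finset F).erase b), sum_congr rfl hfib, sum_const, smul_eq_mul,
    mul_comm, card_erase_eq_ite, card_filter_add_const]
  · simp only [mem_filter, mem_univ, true_and]
    split_ifs <;> simp
  · rintro ⟨k, u⟩ hq
    simp only [coe_filter, mem_univ, true_and, Set.mem_ofPred_eq] at hq
    simp only [coe_erase, coe_filter, mem_univ, true_and, Set.mem_sdiff, Set.mem_ofPred_eq,
      Set.mem_singleton_iff]
    refine ⟨hq.2.1, ?_⟩
    rintro rfl
    have := hq.2.2
    rw [sub_self, zero_add, hq.1] at this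
    exact absurd this (by decide)

/-- The digraph is directed strongly regular as soon as `#{u | χ u = 1, χ (w + u) = -1}` does not
depend on `w ≠ 0`. -/
theorem isDSRGWith_of_card (hω : ∀ x : Fˣ, x ∈ Subgroup.zpowers ω) (hχ : χ ω = ⟨0, 1⟩)
    {f c : ℕ} (hf : #{x | χ x = 1} = f) (hf' : #{x | χ x = -1} = f)
    (hc : ∀ w : F, w ≠ 0 → #{u | χ u = 1 ∧ χ (w + u) = -1} = c) :
    (cayleyDigraph (shiftedSet ω 4 (cyclotomicCoset ω 4 2))).IsDSRGWith
      (Fintype.card F * f) (f * f) (c * (f - 1)) (c * f) (c * f) := by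
  classical
  have hone (x : CyclotomicGroup ω 4) : χ (coords x).2 = 1 :=
    (mem_range_coords_iff hω hχ _).mp ⟨x, rfl⟩
  have hloop (x : CyclotomicGroup ω 4) :
      ¬ (cayleyDigraph (shiftedSet ω 4 (cyclotomicCoset ω 4 2))).Adj x x := by
    rw [adj_iff_coords hω hχ, sub_self, zero_add, hone]
    decide
  have hpath (x y : CyclotomicGroup ω 4) :
      {z | (cayleyDigraph (shiftedSet ω 4 (cyclotomicCoset ω 4 2))).Adj x z ∧
        (cayleyDigraph (shiftedSet ω 4 (cyclotomicCoset ω 4 2))).Adj z y}.ncard = c * (f -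
          if (cayleyDigraph (shiftedSet ω 4 (cyclotomicCoset ω 4 2))).Adj x y then 1 else 0) := by
    simp only [adj_iff_coords hω hχ]
    rw [ncard_coords hω hχ (fun q ↦ χ (q.1 - (coords x).1 + (coords x).2) = -1 ∧
      χ ((coords y).1 - q.1 + q.2) = -1)]
    simp only [sub_add_eq_add_sub _ _ (coords x).2, add_sub_assoc, ← hf']
    exact card_two_paths hc _ _
  refine ⟨Finite.of_injective _ (coords_injective 4), ?_, hloop, fun x ↦ ?_, fun x ↦ ?_,
    fun x ↦ ?_, fun x y _ h ↦ ?_, fun x y _ h ↦ ?_⟩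
  · rw [← Set.ncard_univ]
    refine (ncard_coords hω hχ fun _ ↦ True).trans ?_
    rw [← hf, ← card_univ, ← card_product]
    congr 1
    ext q
    simp
  · simp only [adj_iff_coords hω hχ]
    rw [ncard_coords hω hχ (fun q ↦ χ (q.1 - (coords x).1 + (coords x).2) = -1)]
    simp only [sub_add_eq_add_sub _ _ (coords x).2, add_sub_assoc]
    nth_rw 1 [← hf', ← hf, ← card_filter_add_const ((coords x).2 - (coords x).1), ← card_product]
    congr 1
    ext q
    simp [and_comm]
  · simp only [adj_iff_coords hω hχ]
    rw [ncard_coords hω hχ (fun q ↦ χ ((coords x).1 - q.1 + q.2) = -1)]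
    nth_rw 1 [← hf', ← hf, ← card_product]
    -- For fixed `u`, the map `k ↦ h - k + u` is an involution.
    have hinv (a b u : F) : a - (a - b + u) + u = b := by ring
    refine card_nbij' (fun q ↦ ((coords x).1 - q.1 + q.2, q.2))
      (fun q ↦ ((coords x).1 - q.1 + q.2, q.2)) ?_ ?_ ?_ ?_
    · rintro q hq
      simp_all
    · rintro q hq
      simp_all
    · rintro q -
      simp [hinv]
    · rintro q -
      simp [hinv]
  · rw [hpath x x, if_neg (hloop x), Nat.sub_zero]
  · rw [hpath x y, if_pos h]
  · rw [hpath x y, if_neg h, Nat.sub_zero]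

end Graph

/-! ### The directed strongly regular graph -/

/-- If `|F| ≡ 1` modulo `8`, then `-1` is a fourth power, so every quartic character is trivial
at `-1`. -/
theorem exists_pow_four_eq_neg_one {F : Type*} [Field F] [Fintype F] {ω : Fˣ}
    (hω : ∀ x : Fˣ, x ∈ Subgroup.zpowers ω) {n : ℕ} (hn : 0 < n) (hF : Fintype.card F = 8 * n + 1) :
    ∃ g : F, g ^ 4 = -1 := by
  classical
  have hord : orderOf ω = 8 * n := by
    rw [orderOf_eq_card_of_forall_mem_zpowers hω, Nat.card_eq_fintype_card, Fintype.card_units, hF,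
      Nat.add_sub_cancel]
  have h1 : ((ω ^ n : Fˣ) : F) ^ 8 = 1 := by
    rw [← Units.val_pow_eq_pow_val, ← pow_mul, mul_comm, ← hord, pow_orderOf_eq_one, Units.val_one]
  have h2 : ((ω ^ n : Fˣ) : F) ^ 4 ≠ 1 := by
    rw [← Units.val_pow_eq_pow_val, ← pow_mul, Ne, Units.val_eq_one]
    exact pow_ne_one_of_lt_orderOf (by omega) (by omega)
  refine ⟨(ω ^ n : Fˣ), ?_⟩
  have h3 : (((ω ^ n : Fˣ) : F) ^ 4 - 1) * (((ω ^ n : Fˣ) : F) ^ 4 + 1) = 0 := by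
    linear_combination h1
  exact eq_neg_of_add_eq_zero_left ((mul_eq_zero.mp h3).resolve_left (sub_ne_zero.mpr h2))

theorem theorem4p4 (p : ℕ) [Fact p.Prime] (t : ℤ) (ht : Even t) (hp : (p : ℤ) = 1 + 4 * t ^ 2)
    (ω : (ZMod p)ˣ) (hω : ∀ x : (ZMod p)ˣ, x ∈ Subgroup.zpowers ω) :
    ∃ v k l m τ : ℕ,
      (v : ℚ) = ((p : ℚ) - 1) * p / 4 ∧
      (k : ℚ) = ((p : ℚ) - 1) ^ 2 / 16 ∧
      (l : ℚ) = ((p : ℚ) - 1) ^ 2 / 64 - ((p : ℚ) - 1) / 16 ∧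
      (m : ℚ) = ((p : ℚ) - 1) ^ 2 / 64 ∧
      (τ : ℚ) = ((p : ℚ) - 1) ^ 2 / 64 ∧
      (cayleyDigraph (shiftedSet ω 4 (cyclotomicCoset ω 4 2))).IsDSRGWith v k l m τ := by
  have hpp : p.Prime := Fact.out
  obtain ⟨c, hc⟩ : ∃ c : ℕ, p = 16 * c + 1 := by
    obtain ⟨s, rfl⟩ := ht
    refine ⟨s.natAbs ^ 2, ?_⟩
    zify
    rw [hp, sq_abs]
    ring
  have hc0 : 0 < c := Nat.pos_of_ne_zero fun h ↦ hpp.ne_one (by rw [hc, h])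
  have hcard : Fintype.card (ZMod p) = p := ZMod.card p
  let i : ℤ[i]ˣ := ⟨⟨0, 1⟩, ⟨0, -1⟩, by decide, by decide⟩
  have hi : i ∈ rootsOfUnity (Fintype.card (ZMod p)ˣ) ℤ[i] := by
    have hi4 : i ^ 4 = 1 := by
      ext1
      decide
    rw [mem_rootsOfUnity, ZMod.card_units, hc, Nat.add_sub_cancel,
      show 16 * c = 4 * (4 * c) by ring, pow_mul, hi4, one_pow]
  let χ : MulChar (ZMod p) ℤ[i] := MulChar.ofRootOfUnity hi hω
  have hχ : χ ω = ⟨0, 1⟩ := MulChar.ofRootOfUnity_spec hi hω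
  have h4 : χ ^ 4 = 1 := by
    rw [MulChar.eq_iff hω, MulChar.pow_apply_coe, hχ, MulChar.one_apply_coe]
    decide
  have h2 : χ ^ 2 ≠ 1 := fun h ↦ by
    have := congrArg (fun ψ : MulChar (ZMod p) ℤ[i] ↦ ψ ω) h
    simp only [MulChar.pow_apply_coe, MulChar.one_apply_coe, hχ] at this
    exact absurd this (by decide)
  have hneg : χ (-1) = 1 := by
    obtain ⟨g, hg⟩ := exists_pow_four_eq_neg_one hω (n := 2 * c) (by omega) (by omega)
    have hg0 : g ≠ 0 := by
      rintro rfl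
      norm_num at hg
    rw [← hg, map_pow, MulChar.apply_pow_four h4 hg0]
  have hJ : (jacobiSum χ (χ ^ 2)).re = -1 := by
    have hnorm := norm_jacobiSum_sq h4 h2
    have hmod := re_jacobiSum_modEq h4 h2 hneg
    rw [hcard] at hnorm hmod
    exact eq_neg_one_of_sq_add_sq hpp hp hnorm (by omega)
  have hcount {z : ℤ[i]} (hz : z = 1 ∨ z = -1) : #{x | χ x = z} = 4 * c := by
    have := card_filter_apply_eq χ h4 h2 hz
    omega
  have hD := isDSRGWith_of_card (c := c) hω hχ (hcount (Or.inl rfl)) (hcount (Or.inr rfl))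
    fun w hw ↦ by
      have := card_shift h4 h2 hneg hJ hw
      omega
  rw [hcard] at hD
  have hpQ : (p : ℚ) = 16 * c + 1 := by exact_mod_cast hc
  refine ⟨_, _, _, _, _, ?_, ?_, ?_, ?_, ?_, hD⟩
  · push_cast
    rw [hpQ]
    ring
  · push_cast
    rw [hpQ]
    ring
  · rw [Nat.cast_mul, Nat.cast_sub (by omega)]
    push_cast
    rw [hpQ]
    ring
  · push_cast
    rw [hpQ]
    ring
  · push_cast
    rw [hpQ]
    ring
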